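/- For a number field $K$ let $\mathbb{A}$ be its ring of integers and $\widehat{\mathbb{A}}$ the set of $\theta\in\mathbb{A}$ with $K=\mathbb{Q}(\theta)$. For $\theta\in\mathbb{A}$ let $F_\theta(x)\in\mathbb{Z}[x]$ be the characteristic polynomial of $\theta$ in $K/\mathbb{Q}$, and put $i(\theta)=\gcd_{x\in\mathbb{Z}}F_\theta(x)$; for $\theta\in\widehat{\mathbb{A}}$ let $I(\theta)=[\mathbb{A}:\mathbb{Z}[\theta]]$. Define $$I(K)=\gcd_{\theta\in\widehat{\mathbb{A}}} I(\theta),\qquad i(K)=\operatorname{lcm}_{\theta\in\widehat{\mathbb{A}}} i(\theta).$$ Theorem. Let $m\in\mathbb{Z}$ be such that $p^2\nmid m^4+5m^3+15m^2+25m+25$ for every prime $p\neq 5$. Let $\mathbb{H}_m$ be a number field generated over $\mathbb{Q}$ by a root of Lehmer's quintic polynomial $$h_m(x)=x^5+m^2x^4-(2m^3+6m^2+10m+10)x^3+(m^4+5m^3+11m^2+15m+5)x^2+(m^3+4m^2+10m+10)x+1.$$ Then $I(\mathbb{H}_m)=1$, and $$i(\mathbb{H}_m)=\begin{cases}5 &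 \text{if } m\equiv 2 \pmod 5,\\ 1 & \text{otherwise.}\end{cases}$$ -/

import Mathlib

open Polynomial NumberField

/-- Every set `S` of natural numbers has a greatest common divisor. -/
theorem exists_setGcd (S : Set ℕ) : ∃ g : ℕ, ∀ d : ℕ, d ∣ g ↔ ∀ s ∈ S, d ∣ s := by
  obtain ⟨a, ha⟩ := (IsPrincipalIdealRing.principal
    (Ideal.span ((fun n : ℕ => (n : ℤ)) '' S))).principal
  refine ⟨a.natAbs, fun d => ?_⟩
  have h1 : (d : ℤ) ∣ a ↔ Ideal.span ({a} : Set ℤ) ≤ Ideal.span {(d : ℤ)} :=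
    Ideal.span_singleton_le_span_singleton.symm
  rw [← Int.natCast_dvd, h1, Ideal.span, ← ha, Ideal.span_le]
  constructor
  · intro h s hs
    have := h ⟨s, hs, rfl⟩
    exact Int.natCast_dvd_natCast.mp (Ideal.mem_span_singleton.mp this)
  · rintro h _ ⟨s, hs, rfl⟩
    exact Ideal.mem_span_singleton.mpr (Int.natCast_dvd_natCast.mpr (h s hs))

/-- The greatest common divisor of a (possibly infinite) set of natural numbers. -/
noncomputable def setGcd (S : Set ℕ) : ℕ := Classical.choose (exists_setGcd S)

theorem dvd_setGcd_iff (S : Set ℕ) (d : ℕ) : d ∣ setGcd S ↔ ∀ s ∈ S, d ∣ s :=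
  Classical.choose_spec (exists_setGcd S) d

/-- The least common multiple of a (possibly infinite) set of natural numbers, i.e. the greatest
common divisor of all its common multiples; it is `0` if `0` is the only common multiple. -/
noncomputable def setLcm (S : Set ℕ) : ℕ := setGcd {n : ℕ | ∀ s ∈ S, s ∣ n}

theorem setLcm_dvd_iff (S : Set ℕ) (d : ℕ) : setLcm S ∣ d ↔ ∀ s ∈ S, s ∣ d := by
  constructor
  · intro h s hs
    exact ((dvd_setGcd_iff {n : ℕ | ∀ s ∈ S, s ∣ n} s).mpr fun n hn => hn s hs).trans h
  · intro h
    exact (dvd_setGcd_iff _ _).mp dvd_rfl d h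

section NumberFieldInvariants

variable (K : Type*) [Field K] [NumberField K]

/-- The set of algebraic integers of `K` which are primitive, i.e. generate `K` over `ℚ`. -/
def primitiveIntegers : Set (𝓞 K) :=
  {θ | IntermediateField.adjoin ℚ {(θ : K)} = ⊤}

variable {K}

/-- The index `I(θ) = [𝓞 K : ℤ[θ]]` of an algebraic integer, as an index of additive groups. -/
noncomputable def elementIndex (θ : 𝓞 K) : ℕ :=
  (Algebra.adjoin ℤ {θ}).toSubring.toAddSubgroup.index

/-- The characteristic polynomial `F_θ` of an algebraic integer `θ` of `K`, with its integer
coefficients: that of multiplication by `θ` on the free `ℤ`-module `𝓞 K`. -/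
noncomputable def integralCharpoly (θ : 𝓞 K) : ℤ[X] :=
  (Algebra.lmul ℤ (𝓞 K) θ).charpoly

/-- `F_θ` is the characteristic polynomial of `θ` in the extension `K / ℚ`. -/
theorem map_integralCharpoly (θ : 𝓞 K) :
    (integralCharpoly θ).map (Int.castRingHom ℚ) = (Algebra.lmul ℚ K (θ : K)).charpoly := by
  have h := Algebra.map_leftMulMatrix_localization ℤ (Rₘ := ℚ) (Sₘ := K) (nonZeroDivisors ℤ)
    (RingOfIntegers.basis K) θ
  rw [integralCharpoly, ← LinearMap.charpoly_toMatrix _ (RingOfIntegers.basis K),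
    ← LinearMap.charpoly_toMatrix (Algebra.lmul ℚ K (θ : K)) (integralBasis K),
    ← Matrix.charpoly_map]
  exact congrArg Matrix.charpoly h

/-- `i(θ)`, the greatest common divisor of the values `F_θ(x)`, `x ∈ ℤ`. -/
noncomputable def valueGcd (θ : 𝓞 K) : ℕ :=
  setGcd (Set.range fun x : ℤ => ((integralCharpoly θ).eval x).natAbs)

variable (K)

/-- The index `I(K)`: the gcd of `I(θ)` over all primitive integers `θ` of `K`. -/
noncomputable def fieldIndex : ℕ := setGcd (elementIndex '' primitiveIntegers K)

/-- `i(K)`: the lcm of `i(θ)` over all primitive integers `θ` of `K`. -/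
noncomputable def fieldValueLcm : ℕ := setLcm (valueGcd '' primitiveIntegers K)

end NumberFieldInvariants

/-- Emma Lehmer's quintic polynomial `h_m`. -/
noncomputable def lehmerQuintic (m : ℤ) : ℤ[X] :=
  X ^ 5 + C (m ^ 2) * X ^ 4 - C (2 * m ^ 3 + 6 * m ^ 2 + 10 * m + 10) * X ^ 3
    + C (m ^ 4 + 5 * m ^ 3 + 11 * m ^ 2 + 15 * m + 5) * X ^ 2
    + C (m ^ 3 + 4 * m ^ 2 + 10 * m + 10) * X + 1

/-! `H` is Galois of prime degree 5, so each rational prime `p` is inert, totally ramified or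
totally split (`inert_or_ramified_or_split`). In the first two cases some `θ` generates `𝓞 H` modulo
`p`, hence has index prime to `p`; if `p` splits, this still works when `p ≥ 5`, by choosing
distinct integer residues at the five primes. As `h_m` has no root modulo 2 or 3, these primes do
not split, and `I(H) = 1`.

If `p` divides two consecutive values of some `F_θ`, then `p` splits
(`totallySplit_of_dvd_eval_integralCharpoly`). Since `i(θ) ∣ 5!`, only 5 can contribute, and it does
so exactly when it splits. For `m ≡ 2` modulo 5, `h_m(2)` and `h_m(3)` are consecutive values
divisible by 5; otherwise `not_totallySplit_five` excludes splitting. -/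

/-! ### Indices and values of characteristic polynomials. -/

section ElementIndex

variable {K : Type*} [Field K] [NumberField K]

/-- Nakayama: some `r ≡ 1` modulo `p` satisfies `r • 𝓞 K ⊆ ℤ[θ]`, so the index divides the norm of
`(r)`, a power of `|r|`. -/
theorem not_dvd_elementIndex {p : ℕ} (hp : p.Prime) {θ : 𝓞 K}
    (h : ∀ x : 𝓞 K, ∃ y ∈ Algebra.adjoin ℤ {θ}, x - y ∈ Ideal.span {(p : 𝓞 K)}) :
    ¬ p ∣ elementIndex θ := by
  intro hdvd
  set N : Submodule ℤ (𝓞 K) := Subalgebra.toSubmodule (Algebra.adjoin ℤ {θ}) with hN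
  obtain ⟨r, hr, hrN⟩ := Submodule.exists_sub_one_mem_and_smul_le_of_fg_of_le_sup
    (I := Ideal.span {(p : ℤ)}) (N := N) (N' := ⊤) (P := ⊤) Module.Finite.fg_top le_rfl (by
      rintro x -
      obtain ⟨y, hy, hxy⟩ := h x
      obtain ⟨z, hz⟩ := Ideal.mem_span_singleton.mp hxy
      rw [Submodule.mem_sup]
      refine ⟨y, hy, (p : ℤ) • z, Submodule.smul_mem_smul (Ideal.mem_span_singleton_self _)
        trivial, ?_⟩
      rw [zsmul_eq_mul, Int.cast_natCast, ← hz]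
      ring)
  have hle : (Ideal.span {(r.natAbs : 𝓞 K)}).toAddSubgroup ≤
      (Algebra.adjoin ℤ {θ}).toSubring.toAddSubgroup := by
    intro x hx
    obtain ⟨z, hz⟩ := Ideal.mem_span_singleton.mp hx
    have hmem (t : 𝓞 K) : r • t ∈ N := hrN (Submodule.smul_mem_pointwise_smul t r ⊤ trivial)
    change x ∈ N
    rcases Int.natAbs_eq r with hr' | hr'
    · have := hmem z
      rw [hr', natCast_zsmul, nsmul_eq_mul, ← hz] at this
      exact this
    · have := hmem (-z)
      rw [hr', neg_smul_neg, natCast_zsmul, nsmul_eq_mul, ← hz] at this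
      exact this
  have h1 := AddSubgroup.index_dvd_of_le hle
  rw [← Ideal.absNorm_eq_index, Ideal.absNorm_span_natCast] at h1
  have h2 := hp.dvd_of_dvd_pow (hdvd.trans h1)
  have h3 : (p : ℤ) ∣ r := Int.natCast_dvd.mpr h2
  have h4 := (dvd_sub_right h3).mp (Ideal.mem_span_singleton.mp hr)
  have := Int.natCast_dvd.mp h4
  simp at this
  exact hp.one_lt.ne' this

/-- Infinite index is recorded as 0, so an index prime to `p` also certifies primitivity. -/
theorem mem_primitiveIntegers_of_elementIndex_ne_zero {θ : 𝓞 K} (h : elementIndex θ ≠ 0) :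
    θ ∈ primitiveIntegers K := by
  have hmem (x : 𝓞 K) (hx : x ∈ Algebra.adjoin ℤ {θ}) :
      (x : K) ∈ IntermediateField.adjoin ℚ {(θ : K)} := by
    induction hx using Algebra.adjoin_induction with
    | mem x hx =>
      rw [Set.mem_singleton_iff.mp hx]
      exact IntermediateField.mem_adjoin_simple_self ℚ _
    | algebraMap r => simp
    | add x y _ _ hx hy => simpa using add_mem hx hy
    | mul x y _ _ hx hy => simpa using mul_mem hx hy
  have hmem' (x : 𝓞 K) : (x : K) ∈ IntermediateField.adjoin ℚ {(θ : K)} := by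
    have h1 := hmem _ (AddSubgroup.nsmul_index_mem
      (Algebra.adjoin ℤ {θ}).toSubring.toAddSubgroup x)
    have h2 : ((elementIndex θ : ℕ) : K) * (x : K) ∈ IntermediateField.adjoin ℚ {(θ : K)} := by
      simpa [elementIndex] using h1
    have h3 := mul_mem (inv_mem (natCast_mem (IntermediateField.adjoin ℚ {(θ : K)})
      (elementIndex θ))) h2
    rwa [inv_mul_cancel_left₀ (by exact_mod_cast h)] at h3
  refine top_le_iff.mp fun y _ => ?_
  obtain ⟨a, b, -, rfl⟩ := IsFractionRing.div_surjective (A := 𝓞 K) y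
  exact div_mem (hmem' a) (hmem' b)

theorem aeval_integralCharpoly (θ : 𝓞 K) : aeval θ (integralCharpoly θ) = 0 := by
  have h := LinearMap.aeval_self_charpoly (Algebra.lmul ℤ (𝓞 K) θ)
  rw [aeval_algHom_apply] at h
  simpa [integralCharpoly] using congrArg (fun f => f 1) h

/-- The integral characteristic polynomial takes at `x` a value divisible by `x - θ`. -/
theorem intCast_sub_dvd_eval_integralCharpoly (θ : 𝓞 K) (x : ℤ) :
    (x : 𝓞 K) - θ ∣ (((integralCharpoly θ).eval x : ℤ) : 𝓞 K) := by
  have h2 := sub_dvd_eval_sub (x : 𝓞 K) θ ((integralCharpoly θ).map (algebraMap ℤ (𝓞 K)))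
  rw [eval_map_algebraMap, eval_map_algebraMap, aeval_integralCharpoly,
    sub_zero] at h2
  convert h2 using 1
  rw [aeval_def, eval₂_at_intCast]
  simp

theorem natAbs_eval_integralCharpoly (θ : 𝓞 K) (x : ℤ) :
    ((integralCharpoly θ).eval x).natAbs = Ideal.absNorm (Ideal.span {(x : 𝓞 K) - θ}) := by
  rw [Ideal.absNorm_span_singleton, integralCharpoly, LinearMap.eval_charpoly, Algebra.norm_apply]
  congr 3
  simp [map_sub]

theorem exists_isMaximal_of_dvd_eval_integralCharpoly {p : ℕ} (hp : p.Prime) (θ : 𝓞 K) (x : ℤ)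
    (h : (p : ℤ) ∣ (integralCharpoly θ).eval x) :
    ∃ P : Ideal (𝓞 K), P.IsMaximal ∧ (p : 𝓞 K) ∈ P ∧ (x : 𝓞 K) - θ ∈ P := by
  rw [Int.natCast_dvd, natAbs_eval_integralCharpoly] at h
  obtain ⟨P, hP, hPp, hdvd⟩ := Ideal.exists_isMaximal_dvd_of_dvd_absNorm' hp _ h
  refine ⟨P, hP, ?_, Ideal.dvd_iff_le.mp hdvd (Ideal.mem_span_singleton_self _)⟩
  have : (p : ℤ) ∈ P.under ℤ := hPp ▸ Ideal.mem_span_singleton_self _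
  simpa using this

theorem monic_integralCharpoly (θ : 𝓞 K) : (integralCharpoly θ).Monic :=
  LinearMap.charpoly_monic _

theorem natDegree_integralCharpoly (θ : 𝓞 K) :
    (integralCharpoly θ).natDegree = Module.finrank ℚ K := by
  rw [integralCharpoly, LinearMap.charpoly_natDegree, RingOfIntegers.rank]

theorem dvd_valueGcd_iff (θ : 𝓞 K) (d : ℕ) :
    d ∣ valueGcd θ ↔ ∀ x : ℤ, (d : ℤ) ∣ (integralCharpoly θ).eval x := by
  rw [valueGcd, dvd_setGcd_iff, Set.forall_mem_range]
  simp_rw [Int.natCast_dvd]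

/-- The values of a monic quintic have greatest common divisor dividing `5!`. -/
theorem valueGcd_dvd_of_finrank_eq_five (h5 : Module.finrank ℚ K = 5) (θ : 𝓞 K) :
    valueGcd θ ∣ 120 := by
  have hd := (dvd_valueGcd_iff θ (valueGcd θ)).mp dvd_rfl
  set F := integralCharpoly θ with hF
  have hdeg : F.natDegree = 5 := by rw [hF, natDegree_integralCharpoly, h5]
  have hlead : F.coeff 5 = 1 := by
    rw [← hdeg]; exact monic_integralCharpoly θ
  -- The fifth finite difference of a monic quintic is `5!`.
  have h : F.eval 5 - 5 * F.eval 4 + 10 * F.eval 3 - 10 * F.eval 2 + 5 * F.eval 1 - F.eval 0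
      = 120 := by
    simp only [eval_eq_sum_range, hdeg, Finset.sum_range_succ, Finset.sum_range_zero, hlead]
    ring
  have : ((valueGcd θ : ℕ) : ℤ) ∣ 120 := by
    rw [← h]
    exact dvd_sub (dvd_add (dvd_sub (dvd_add (dvd_sub (hd 5) ((hd 4).mul_left _))
      ((hd 3).mul_left _)) ((hd 2).mul_left _)) ((hd 1).mul_left _)) (hd 0)
  exact_mod_cast this

end ElementIndex

/-! ### Approximation at the primes above a split prime. -/

section SplitPrimes

variable {K : Type*} [Field K]

theorem exists_forall_sub_intCast_mem {ℓ : ℕ} {P : Fin ℓ → Ideal (𝓞 K)}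
    (hinj : Function.Injective P) (hP : ∀ i, (P i).IsMaximal) (a : Fin ℓ → ℤ) :
    ∃ θ : 𝓞 K, ∀ i, θ - a i ∈ P i := by
  refine Ideal.exists_forall_sub_mem_ideal (fun i j hij => ?_) fun i => (a i : 𝓞 K)
  have := hP i
  have := hP j
  exact Ideal.isCoprime_of_isMaximal (fun h => hij (hinj h))

/-- Lagrange interpolation: since `ℓ ≤ p`, the nodes `0, …, ℓ - 1` are distinct modulo `p`, so an
integer polynomial in `θ` can match the residues of `x` at every `P i`. -/
theorem adjoin_sub_mem_of_split {p : ℕ} (hp : p.Prime) {ℓ : ℕ} (hℓ : ℓ ≤ p)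
    {P : Fin ℓ → Ideal (𝓞 K)} (hpP : Ideal.span {(p : 𝓞 K)} = ⨅ i, P i)
    (hres : ∀ i, ∀ x : 𝓞 K, ∃ n : ℤ, x - n ∈ P i)
    {θ : 𝓞 K} (hθ : ∀ i, θ - (i : ℤ) ∈ P i) (x : 𝓞 K) :
    ∃ y ∈ Algebra.adjoin ℤ {θ}, x - y ∈ Ideal.span {(p : 𝓞 K)} := by
  have : Fact p.Prime := ⟨hp⟩
  choose b hb using fun i => hres i x
  let r : (ZMod p)[X] := Lagrange.interpolate Finset.univ (fun i : Fin ℓ => ((i : ℕ) : ZMod p))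
    fun i => (b i : ZMod p)
  obtain ⟨s, hs⟩ := map_surjective (Int.castRingHom (ZMod p)) ZMod.intCast_surjective r
  have hinj : Set.InjOn (fun i : Fin ℓ => ((i : ℕ) : ZMod p)) (Finset.univ : Finset (Fin ℓ)) := by
    intro i _ j _ hij
    have := (ZMod.natCast_eq_natCast_iff' _ _ _).mp hij
    rw [Nat.mod_eq_of_lt (i.2.trans_le hℓ), Nat.mod_eq_of_lt (j.2.trans_le hℓ)] at this
    exact Fin.ext this
  have heval (i : Fin ℓ) : (p : ℤ) ∣ s.eval (i : ℤ) - b i := by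
    rw [← ZMod.intCast_zmod_eq_zero_iff_dvd, Int.cast_sub, sub_eq_zero]
    have h := Lagrange.eval_interpolate_at_node (fun i : Fin ℓ => (b i : ZMod p)) hinj
      (Finset.mem_univ i)
    rw [← h]
    change _ = eval _ r
    rw [← hs]
    simp
  have hpmem (i : Fin ℓ) : (p : 𝓞 K) ∈ P i :=
    (hpP ▸ Ideal.mem_span_singleton_self (p : 𝓞 K) : (p : 𝓞 K) ∈ ⨅ i, P i) |> fun h =>
      (Ideal.mem_iInf.mp h) i
  refine ⟨aeval θ s, aeval_mem_adjoin_singleton ℤ θ, ?_⟩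
  rw [hpP, Ideal.mem_iInf]
  intro i
  have h1 : aeval θ s - ((s.eval (i : ℤ) : ℤ) : 𝓞 K) ∈ P i := by
    refine Ideal.mem_of_dvd _ ?_ (hθ i)
    have := sub_dvd_eval_sub θ (((i : ℤ)) : 𝓞 K) (s.map (algebraMap ℤ (𝓞 K)))
    rw [eval_map_algebraMap, eval_map_algebraMap] at this
    convert this using 2
    rw [aeval_def, eval₂_at_intCast]
    simp
  have h2 : ((s.eval (i : ℤ) : ℤ) : 𝓞 K) - b i ∈ P i := by
    obtain ⟨c, hc⟩ := heval i
    rw [← Int.cast_sub, hc, Int.cast_mul]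
    exact (P i).mul_mem_right _ (by simpa using hpmem i)
  have : x - aeval θ s = (x - b i) - (((s.eval (i : ℤ) : ℤ) : 𝓞 K) - b i)
    - (aeval θ s - ((s.eval (i : ℤ) : ℤ) : 𝓞 K)) := by ring
  rw [this]
  exact sub_mem (sub_mem (hb i) h2) h1

theorem intCast_dvd_of_mem {p : ℕ} (hp : p.Prime) {P : Ideal (𝓞 K)} (hP : P ≠ ⊤)
    (hpP : (p : 𝓞 K) ∈ P) {n : ℤ} (hn : (n : 𝓞 K) ∈ P) : (p : ℤ) ∣ n := by
  by_contra h
  obtain ⟨a, b, hab⟩ := (Nat.prime_iff_prime_int.mp hp).coprime_iff_not_dvd.mpr h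
  refine hP ((Ideal.eq_top_iff_one _).mpr ?_)
  have := congrArg (Int.cast : ℤ → 𝓞 K) hab
  push_cast at this
  rw [← this]
  exact add_mem (P.mul_mem_left _ hpP) (P.mul_mem_left _ hn)

end SplitPrimes

/-! ### Decomposition of primes in Galois fields of prime degree. -/

section Splitting

variable {K : Type*} [Field K] [NumberField K]

theorem exists_intCast_sub_mem_of_absNorm_eq {p : ℕ} (hp : p.Prime) {P : Ideal (𝓞 K)}
    (h : Ideal.absNorm P = p) (x : 𝓞 K) : ∃ n : ℤ, x - n ∈ P := by
  have hcard : Nat.card (𝓞 K ⧸ P) = p := h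
  have : Finite (𝓞 K ⧸ P) := (Nat.card_pos_iff.mp (hcard ▸ hp.pos)).2
  have : Fintype (𝓞 K ⧸ P) := Fintype.ofFinite _
  have : NeZero p := ⟨hp.ne_zero⟩
  let e := ZMod.ringEquivOfPrime (𝓞 K ⧸ P) hp (by rw [← Nat.card_eq_fintype_card, hcard])
  obtain ⟨z, hz⟩ := e.surjective (Ideal.Quotient.mk P x)
  refine ⟨(z.val : ℤ), Ideal.Quotient.eq.mp ?_⟩
  rw [← hz]
  conv_lhs => rw [← ZMod.natCast_zmod_val z, map_natCast]
  rw [Int.cast_natCast, map_natCast]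

variable (K) in
/-- `p` is a product of `ℓ` distinct primes of `K` of residue degree one. -/
def TotallySplit (ℓ p : ℕ) : Prop :=
  ∃ P : Fin ℓ → Ideal (𝓞 K), Function.Injective P ∧ (∀ i, (P i).IsMaximal) ∧
    Ideal.span {(p : 𝓞 K)} = ⨅ i, P i ∧ ∀ i, ∀ x : 𝓞 K, ∃ n : ℤ, x - n ∈ P i

/-- In a Galois number field of prime degree `ℓ`, a rational prime is inert, totally ramified or
totally split. -/
theorem inert_or_ramified_or_split [IsGalois ℚ K] {ℓ : ℕ} (hℓ : ℓ.Prime)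
    (hK : Module.finrank ℚ K = ℓ) {p : ℕ} (hp : p.Prime) :
    (Ideal.span {(p : 𝓞 K)}).IsMaximal ∨
    (∃ P : Ideal (𝓞 K), P.IsMaximal ∧ P ≠ ⊥ ∧ Ideal.span {(p : 𝓞 K)} = P ^ ℓ ∧
      ∀ x : 𝓞 K, ∃ n : ℤ, x - n ∈ P) ∨
    TotallySplit K ℓ p := by
  classical
  set q : Ideal ℤ := Ideal.span {(p : ℤ)} with hq
  have hpZ : Prime (p : ℤ) := Nat.prime_iff_prime_int.mp hp
  have hq0 : q ≠ ⊥ := by simpa [hq] using hp.ne_zero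
  have hqP : q.IsPrime := (Ideal.span_singleton_prime hpZ.ne_zero).mpr hpZ
  have hqM : q.IsMaximal := hqP.isMaximal hq0
  have hmap : Ideal.span {(p : 𝓞 K)} = q.map (algebraMap ℤ (𝓞 K)) := by
    rw [hq, Ideal.map_span]; simp
  have key := Ideal.ncard_primesOver_mul_ramificationIdxIn_mul_inertiaDegIn q (𝓞 K) Gal(K/ℚ)
  rw [IsGalois.card_aut_eq_finrank, hK] at key
  set e := q.ramificationIdxIn (𝓞 K) with he
  set f := q.inertiaDegIn (𝓞 K) with hf
  have hfin : (q.primesOver (𝓞 K)).Finite := IsDedekindDomain.primesOver_finite q (𝓞 K)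
  have hmax (P : Ideal (𝓞 K)) (hP : P ∈ q.primesOver (𝓞 K)) : P.IsMaximal ∧ P ≠ ⊥ := by
    have h0 : P ≠ ⊥ := Ideal.ne_bot_of_mem_primesOver hq0 hP
    exact ⟨hP.1.isMaximal h0, h0⟩
  have hram (P : Ideal (𝓞 K)) (hP : P ∈ q.primesOver (𝓞 K)) : P.ramificationIdx ℤ = e := by
    have := hP.1
    have := hP.2
    exact (Ideal.ramificationIdxIn_eq_ramificationIdx q P Gal(K/ℚ)).symm
  have hres (hf1 : f = 1) (P : Ideal (𝓞 K)) (hP : P ∈ q.primesOver (𝓞 K)) (x : 𝓞 K) :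
      ∃ n : ℤ, x - n ∈ P := by
    have := hP.1
    have := hP.2
    have := (hmax P hP).1
    refine exists_intCast_sub_mem_of_absNorm_eq hp ?_ x
    rw [Ideal.absNorm_eq_pow_inertiaDeg' P hp, Ideal.inertiaDeg'_eq_inertiaDeg,
      ← Ideal.inertiaDegIn_eq_inertiaDeg q P Gal(K/ℚ), ← hf, hf1, pow_one]
  have hprod : Ideal.span {(p : 𝓞 K)} = ∏ P ∈ hfin.toFinset, P ^ e := by
    rw [hmap, Ideal.map_algebraMap_eq_finsetProd_pow hq0]
    refine Finset.prod_congr (by ext; simp) fun P hP => ?_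
    rw [hram P (by simpa using hP)]
  rw [Set.ncard_eq_toFinset_card _ hfin] at key
  -- With `g` primes above `p`, `g * (e * f) = ℓ` is prime, so exactly one of `g`, `e`, `f` is `ℓ`
  -- and the others are 1.
  rcases hℓ.eq_one_or_self_of_dvd _ ⟨_, key.symm⟩ with h1 | h1
  · obtain ⟨P, hP⟩ := Finset.card_eq_one.mp h1
    have hPm : P ∈ q.primesOver (𝓞 K) := by
      rw [← hfin.mem_toFinset, hP]; exact Finset.mem_singleton_self _
    rw [hP, Finset.prod_singleton] at hprod
    rw [h1, one_mul] at key
    rcases hℓ.eq_one_or_self_of_dvd _ ⟨_, key.symm⟩ with h2 | h2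
    · left
      rw [hprod, h2, pow_one]
      exact (hmax P hPm).1
    · right; left
      refine ⟨P, (hmax P hPm).1, (hmax P hPm).2, by rw [hprod, h2], hres ?_ P hPm⟩
      rw [h2] at key
      exact Nat.eq_of_mul_eq_mul_left hℓ.pos (by rw [key, mul_one])
  · right; right
    rw [h1] at key
    have hef : e * f = 1 := Nat.eq_of_mul_eq_mul_left hℓ.pos (by rw [key, mul_one])
    have he1 : e = 1 := Nat.eq_one_of_mul_eq_one_right hef
    have hf1 : f = 1 := Nat.eq_one_of_mul_eq_one_left hef
    let g := (Finset.equivFinOfCardEq h1).symm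
    have hg (i : Fin ℓ) : (g i : Ideal (𝓞 K)) ∈ q.primesOver (𝓞 K) :=
      hfin.mem_toFinset.mp (g i).2
    have hinj : Function.Injective fun i => (g i : Ideal (𝓞 K)) :=
      Subtype.val_injective.comp g.injective
    refine ⟨fun i => g i, hinj, fun i => (hmax _ (hg i)).1, ?_, fun i => hres hf1 _ (hg i)⟩
    rw [hprod, he1]
    simp only [pow_one]
    rw [← Finset.prod_coe_sort, ← g.prod_comp, Ideal.prod_eq_iInf_of_pairwise_isCoprime]
    · simp
    intro i _ j _ hij
    have := (hmax _ (hg i)).1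
    have := (hmax _ (hg j)).1
    exact Ideal.isCoprime_of_isMaximal (fun h => hij (hinj h))

/-- `P` is the only prime above `p`, so it would contain both `a - θ` and `a + 1 - θ`, hence 1. The
inert case is `ℓ = 1`. -/
theorem not_dvd_eval_integralCharpoly_succ {p : ℕ} (hp : p.Prime) {ℓ : ℕ}
    {P : Ideal (𝓞 K)} (hP : P.IsMaximal) (h : Ideal.span {(p : 𝓞 K)} = P ^ ℓ) (θ : 𝓞 K) (a : ℤ)
    (h0 : (p : ℤ) ∣ (integralCharpoly θ).eval a) :
    ¬ (p : ℤ) ∣ (integralCharpoly θ).eval (a + 1) := by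
  intro h1
  have huniq (Q : Ideal (𝓞 K)) (hQ : Q.IsMaximal) (hpQ : (p : 𝓞 K) ∈ Q) : Q = P := by
    refine (hP.eq_of_le hQ.ne_top (Ideal.IsPrime.le_of_pow_le (hP := hQ.isPrime) (n := ℓ) ?_)).symm
    rw [← h]
    exact (Ideal.span_singleton_le_iff_mem _).mpr hpQ
  obtain ⟨Q, hQ, hpQ, hQ0⟩ := exists_isMaximal_of_dvd_eval_integralCharpoly hp θ a h0
  obtain ⟨R, hR, hpR, hR1⟩ := exists_isMaximal_of_dvd_eval_integralCharpoly hp θ (a + 1) h1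
  rw [huniq Q hQ hpQ] at hQ0
  rw [huniq R hR hpR] at hR1
  refine hP.ne_top ((Ideal.eq_top_iff_one _).mpr ?_)
  simpa using sub_mem hR1 hQ0

/-- If two consecutive values of the characteristic polynomial of an integer of a Galois number
field of prime degree are divisible by `p`, then `p` splits totally. -/
theorem totallySplit_of_dvd_eval_integralCharpoly [IsGalois ℚ K] {ℓ : ℕ} (hℓ : ℓ.Prime)
    (hK : Module.finrank ℚ K = ℓ) {p : ℕ} (hp : p.Prime) (θ : 𝓞 K) (a : ℤ)
    (h0 : (p : ℤ) ∣ (integralCharpoly θ).eval a)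
    (h1 : (p : ℤ) ∣ (integralCharpoly θ).eval (a + 1)) : TotallySplit K ℓ p := by
  rcases inert_or_ramified_or_split hℓ hK hp with h | ⟨P, hP, -, hpP, -⟩ | h
  · exact absurd h1 (not_dvd_eval_integralCharpoly_succ hp h (pow_one _).symm θ a h0)
  · exact absurd h1 (not_dvd_eval_integralCharpoly_succ hp hP hpP θ a h0)
  · exact h

/-- The residue field is finite with cyclic unit group; `θ` lifts a generator, whose powers give
every nonzero residue. -/
theorem exists_adjoin_sub_mem_of_inert {p : ℕ}
    (hP : (Ideal.span {(p : 𝓞 K)}).IsMaximal) (hp : p ≠ 0) :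
    ∃ θ : 𝓞 K, ∀ x : 𝓞 K, ∃ y ∈ Algebra.adjoin ℤ {θ}, x - y ∈ Ideal.span {(p : 𝓞 K)} := by
  set P := Ideal.span {(p : 𝓞 K)} with hPdef
  let _ : Field (𝓞 K ⧸ P) := Ideal.Quotient.field P
  have : Finite (𝓞 K ⧸ P) := by
    rw [← Ideal.absNorm_ne_zero_iff, hPdef, Ideal.absNorm_span_natCast]
    exact pow_ne_zero _ hp
  obtain ⟨ζ, hζ⟩ := IsCyclic.exists_generator (α := (𝓞 K ⧸ P)ˣ)
  obtain ⟨θ, hθ⟩ := Ideal.Quotient.mk_surjective (ζ : 𝓞 K ⧸ P)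
  refine ⟨θ, fun x => ?_⟩
  by_cases hx : Ideal.Quotient.mk P x = 0
  · exact ⟨0, zero_mem _, by simpa using Ideal.Quotient.eq_zero_iff_mem.mp hx⟩
  · obtain ⟨k, hk⟩ := (mem_powers_iff_mem_zpowers (x := ζ)).mpr (hζ (Units.mk0 _ hx))
    refine ⟨θ ^ k, pow_mem (Algebra.self_mem_adjoin_singleton ℤ θ) k, Ideal.Quotient.eq.mp ?_⟩
    have := congrArg Units.val hk
    simp only [Units.val_pow_eq_pow_val, Units.val_mk0, ← hθ] at this
    rw [map_pow, this]

/-- A uniformizer `θ ∈ P \ P ^ 2` works: residue degree one allows `P`-adic expansions in powers of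
`θ` with integer digits. -/
theorem exists_adjoin_sub_mem_of_ramified {P : Ideal (𝓞 K)} (hP : P.IsMaximal) (hP0 : P ≠ ⊥)
    (hres : ∀ x : 𝓞 K, ∃ n : ℤ, x - n ∈ P) (k : ℕ) :
    ∃ θ : 𝓞 K, ∀ x : 𝓞 K, ∃ y ∈ Algebra.adjoin ℤ {θ}, x - y ∈ P ^ k := by
  obtain ⟨θ, hθ, hθ'⟩ := SetLike.exists_of_lt
    (Ideal.pow_right_strictAnti P hP0 hP.ne_top (Nat.lt_succ_self 1))
  replace hθ : θ ∈ P := by simpa using hθ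
  replace hθ' : θ ∉ P ^ 2 := hθ'
  refine ⟨θ, ?_⟩
  induction k with
  | zero => exact fun x => ⟨0, zero_mem _, by simp⟩
  | succ k ih =>
    intro x
    obtain ⟨y, hy, hxy⟩ := ih x
    have hnot : θ ^ k ∉ P ^ (k + 1) := by
      obtain ⟨J, hJ⟩ := Ideal.dvd_span_singleton.mpr hθ
      have hprime : Prime P := Ideal.prime_of_isPrime hP0 hP.isPrime
      rw [← Ideal.dvd_span_singleton, ← Ideal.span_singleton_pow, hJ, mul_pow, pow_succ,
        mul_dvd_mul_iff_left (pow_ne_zero _ hprime.ne_zero)]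
      intro hdvd
      refine hθ' (Ideal.dvd_span_singleton.mp ?_)
      rw [hJ, pow_two]
      exact mul_dvd_mul_left P (hprime.dvd_of_dvd_pow hdvd)
    obtain ⟨d, e, he, hde⟩ := Ideal.exists_mul_add_mem_pow_succ hP0 (θ ^ k) (x - y)
      (Ideal.pow_mem_pow hθ k) hnot hxy
    obtain ⟨n, hn⟩ := hres d
    refine ⟨y + θ ^ k * n, add_mem hy (mul_mem
      (pow_mem (Algebra.self_mem_adjoin_singleton ℤ θ) k) (intCast_mem _ n)), ?_⟩
    have : x - (y + θ ^ k * n) = θ ^ k * (d - n) + e := by linear_combination -hde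
    rw [this, pow_succ]
    exact add_mem (Ideal.mul_mem_mul (Ideal.pow_mem_pow hθ k) hn) (by rwa [← pow_succ])

/-- In a Galois number field of prime degree `ℓ`, a rational prime dividing every index is smaller
than `ℓ` and splits totally. -/
theorem exists_not_dvd_elementIndex [IsGalois ℚ K] {ℓ : ℕ} (hℓ : ℓ.Prime)
    (hK : Module.finrank ℚ K = ℓ) {p : ℕ} (hp : p.Prime) (h : TotallySplit K ℓ p → ℓ ≤ p) :
    ∃ θ : 𝓞 K, ¬ p ∣ elementIndex θ := by
  rcases inert_or_ramified_or_split hℓ hK hp with hP | ⟨P, hP, hP0, hpP, hres⟩ | hs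
  · obtain ⟨θ, hθ⟩ := exists_adjoin_sub_mem_of_inert hP hp.ne_zero
    exact ⟨θ, not_dvd_elementIndex hp hθ⟩
  · obtain ⟨θ, hθ⟩ := exists_adjoin_sub_mem_of_ramified hP hP0 hres ℓ
    exact ⟨θ, not_dvd_elementIndex hp (hpP ▸ hθ)⟩
  · have hle := h hs
    obtain ⟨P, hinj, hP, hpP, hres⟩ := hs
    obtain ⟨θ, hθ⟩ := exists_forall_sub_intCast_mem hinj hP fun i => (i : ℤ)
    exact ⟨θ, not_dvd_elementIndex hp (adjoin_sub_mem_of_split hp hle hpP hres hθ)⟩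

/-- If `p = ℓ` splits totally in a field of degree `ℓ`, some integer generating the field has all
values of its characteristic polynomial divisible by `p`. -/
theorem TotallySplit.exists_dvd_valueGcd {p : ℕ} (hp : p.Prime) (h : TotallySplit K p p) :
    ∃ θ ∈ primitiveIntegers K, p ∣ valueGcd θ := by
  obtain ⟨P, hinj, hP, hpP, hres⟩ := h
  obtain ⟨θ, hθ⟩ := exists_forall_sub_intCast_mem hinj hP fun i => (i : ℤ)
  have hindex := not_dvd_elementIndex hp (adjoin_sub_mem_of_split hp le_rfl hpP hres hθ)
  refine ⟨θ, mem_primitiveIntegers_of_elementIndex_ne_zero fun h => hindex (h ▸ dvd_zero p), ?_⟩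
  rw [dvd_valueGcd_iff]
  intro x
  have hp0 : (p : ℤ) ≠ 0 := by exact_mod_cast hp.ne_zero
  -- The residues of `θ` exhaust `ZMod p`, so every `x` agrees with `θ` modulo some `P i`.
  obtain ⟨i, hi⟩ : ∃ i : Fin p, (p : ℤ) ∣ x - (i : ℤ) := by
    have h1 := Int.emod_nonneg x hp0
    have h2 := Int.emod_lt_of_pos x (by exact_mod_cast hp.pos : (0 : ℤ) < p)
    refine ⟨⟨(x % p).toNat, by omega⟩, ?_⟩
    simp only [Int.toNat_of_nonneg h1]
    exact Int.dvd_self_sub_emod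
  have hpi : (p : 𝓞 K) ∈ P i :=
    Ideal.mem_iInf.mp (hpP ▸ Ideal.mem_span_singleton_self (p : 𝓞 K)) i
  refine intCast_dvd_of_mem hp (hP i).ne_top hpi
    (Ideal.mem_of_dvd _ (intCast_sub_dvd_eval_integralCharpoly θ x) ?_)
  obtain ⟨c, hc⟩ := hi
  have hx : (x : 𝓞 K) - θ = p * c - (θ - (i : ℤ)) := by
    have := congrArg (Int.cast : ℤ → 𝓞 K) hc
    push_cast at this ⊢
    linear_combination this
  rw [hx]
  exact sub_mem ((P i).mul_mem_right _ hpi) (hθ i)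

end Splitting

/-! ### Irreducibility of Lehmer's quintic and the Galois property. -/

section Lehmer

theorem eval₂_lehmerQuintic {R : Type*} [CommRing R] (f : ℤ →+* R) (m : ℤ) (x : R) :
    (lehmerQuintic m).eval₂ f x = x ^ 5 + (m : R) ^ 2 * x ^ 4
      - (2 * (m : R) ^ 3 + 6 * (m : R) ^ 2 + 10 * (m : R) + 10) * x ^ 3
      + ((m : R) ^ 4 + 5 * (m : R) ^ 3 + 11 * (m : R) ^ 2 + 15 * (m : R) + 5) * x ^ 2
      + ((m : R) ^ 3 + 4 * (m : R) ^ 2 + 10 * (m : R) + 10) * x + 1 := by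
  simp only [lehmerQuintic, eval₂_add, eval₂_sub, eval₂_mul, eval₂_pow, eval₂_X, eval₂_C, eval₂_one]
  simp only [eq_intCast]
  push_cast
  rfl

theorem aeval_lehmerQuintic {R : Type*} [CommRing R] (m : ℤ) (x : R) :
    aeval x (lehmerQuintic m) = x ^ 5 + (m : R) ^ 2 * x ^ 4
      - (2 * (m : R) ^ 3 + 6 * (m : R) ^ 2 + 10 * (m : R) + 10) * x ^ 3
      + ((m : R) ^ 4 + 5 * (m : R) ^ 3 + 11 * (m : R) ^ 2 + 15 * (m : R) + 5) * x ^ 2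
      + ((m : R) ^ 3 + 4 * (m : R) ^ 2 + 10 * (m : R) + 10) * x + 1 :=
  eval₂_lehmerQuintic _ m x

theorem natDegree_lehmerQuintic (m : ℤ) : (lehmerQuintic m).natDegree = 5 := by
  unfold lehmerQuintic; compute_degree!

theorem monic_lehmerQuintic (m : ℤ) : (lehmerQuintic m).Monic := by
  unfold lehmerQuintic; monicity!

/-- The two forms are for `m` even and odd; they display remainder 1 on division by the only
irreducible quadratic over `ZMod 2`. -/
theorem map_two_lehmerQuintic (m : ℤ) :
    (lehmerQuintic m).map (Int.castRingHom (ZMod 2)) = (X ^ 2 + X + 1) * (X ^ 3 + X ^ 2) + 1 ∨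
    (lehmerQuintic m).map (Int.castRingHom (ZMod 2)) = (X ^ 2 + X + 1) * (X ^ 3 + X) + 1 := by
  have h2 : (2 : (ZMod 2)[X]) = 0 := CharTwo.two_eq_zero
  have hmap : (lehmerQuintic m).map (Int.castRingHom (ZMod 2)) =
      (lehmerQuintic m).eval₂ (Int.castRingHom (ZMod 2)[X]) X := by
    rw [← eval₂_C_X (p := map _ _), eval₂_map]
    congr 1
  rw [hmap, eval₂_lehmerQuintic]
  have hm : (m : (ZMod 2)[X]) = 0 ∨ (m : (ZMod 2)[X]) = 1 := by
    have h : (m : ZMod 2) = 0 ∨ (m : ZMod 2) = 1 := by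
      generalize (m : ZMod 2) = a; revert a; decide
    simpa using h.imp (congrArg C) (congrArg C)
  rcases hm with hm | hm <;> rw [hm]
  · left
    linear_combination (-5 * X ^ 3 + 2 * X ^ 2 + 5 * X - X ^ 3 - X ^ 4) * h2
  · right
    linear_combination (-15 * X ^ 3 + 18 * X ^ 2 + 12 * X) * h2

theorem irreducible_map_two_lehmerQuintic (m : ℤ) :
    Irreducible ((lehmerQuintic m).map (Int.castRingHom (ZMod 2))) := by
  have hmon := (monic_lehmerQuintic m).map (Int.castRingHom (ZMod 2))
  have hdeg : ((lehmerQuintic m).map (Int.castRingHom (ZMod 2))).natDegree = 5 := by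
    rw [(monic_lehmerQuintic m).natDegree_map, natDegree_lehmerQuintic]
  set f := (lehmerQuintic m).map (Int.castRingHom (ZMod 2)) with hf
  have hf1 : f ≠ 1 := fun h => by simp [h] at hdeg
  have hnr (a : ZMod 2) : f.eval a ≠ 0 := by
    rcases map_two_lehmerQuintic m with h | h <;> rw [hf, h] <;> simp <;> revert a <;> decide
  have hroot (g : (ZMod 2)[X]) (hg : g ∣ f) (a : ZMod 2) : g.eval a ≠ 0 := fun h =>
    hnr a (eval_eq_zero_of_dvd_of_eval_eq_zero hg h)
  rw [hmon.irreducible_iff_lt_natDegree_lt hf1]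
  intro g hg hgdeg hdvd
  rw [hdeg, Finset.mem_Ioc] at hgdeg
  have hd : g.natDegree = 1 ∨ g.natDegree = 2 := by omega
  have h0 := hroot g hdvd 0
  have h1 := hroot g hdvd 1
  rcases hd with hd | hd
  · have hlead : g.coeff 1 = 1 := hd ▸ hg.coeff_natDegree
    simp only [eval_eq_sum_range, hd, Finset.sum_range_succ, Finset.sum_range_zero, hlead] at h0 h1
    generalize g.coeff 0 = a at h0 h1
    revert a; decide
  · have hlead := hg.coeff_natDegree
    rw [hd] at hlead
    simp only [eval_eq_sum_range, hd, Finset.sum_range_succ, Finset.sum_range_zero, hlead] at h0 h1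
    have hg' : g = X ^ 2 + X + 1 := by
      have h01 : g.coeff 0 = 1 ∧ g.coeff 1 = 1 := by
        generalize g.coeff 0 = a at h0 h1
        generalize g.coeff 1 = b at h0 h1
        revert a b; decide
      rw [g.as_sum_range, hd]
      simp [Finset.sum_range_succ, hlead, h01, ← C_mul_X_pow_eq_monomial]
      ring
    have hunit : g ∣ 1 := by
      rcases map_two_lehmerQuintic m with h | h <;> rw [← hf, ← hg'] at h <;>
        exact (dvd_add_right (dvd_mul_right g _)).mp (h.subst (motive := fun t => g ∣ t) hdvd)
    have := natDegree_eq_zero_of_isUnit (isUnit_of_dvd_one hunit)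
    omega

theorem irreducible_lehmerQuintic (m : ℤ) : Irreducible (lehmerQuintic m) :=
  (monic_lehmerQuintic m).irreducible_of_irreducible_map (Int.castRingHom (ZMod 2)) _
    (irreducible_map_two_lehmerQuintic m)

variable {H : Type*} [Field H] [NumberField H] {m : ℤ} {α : H}

theorem minpoly_eq_lehmerQuintic (hroot : aeval α (lehmerQuintic m) = 0) :
    minpoly ℚ α = (lehmerQuintic m).map (algebraMap ℤ ℚ) :=
  (minpoly.eq_of_irreducible_of_monic
    (((monic_lehmerQuintic m).irreducible_iff_irreducible_map_fraction_map (K := ℚ)).mp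
      (irreducible_lehmerQuintic m))
    (by rwa [aeval_map_algebraMap]) ((monic_lehmerQuintic m).map _)).symm

theorem natDegree_minpoly_lehmer (hroot : aeval α (lehmerQuintic m) = 0) :
    (minpoly ℚ α).natDegree = 5 := by
  rw [minpoly_eq_lehmerQuintic hroot, (monic_lehmerQuintic m).natDegree_map,
    natDegree_lehmerQuintic]

theorem finrank_lehmer (hroot : aeval α (lehmerQuintic m) = 0)
    (hgen : IntermediateField.adjoin ℚ {α} = ⊤) : Module.finrank ℚ H = 5 := by
  rw [← natDegree_minpoly_lehmer hroot, ← IntermediateField.adjoin.finrank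
    (Algebra.IsIntegral.isIntegral α), hgen, IntermediateField.finrank_top']

theorem quadratic_ne_zero (hroot : aeval α (lehmerQuintic m) = 0) {a b c : ℤ}
    (h : a * α ^ 2 + b * α + c = 0) : a = 0 ∧ b = 0 ∧ c = 0 := by
  set q : ℚ[X] := C (a : ℚ) * X ^ 2 + C (b : ℚ) * X + C (c : ℚ) with hq
  have hq0 : q = 0 := by
    by_contra hne
    have h1 := natDegree_le_natDegree (minpoly.degree_le_of_ne_zero ℚ α hne (by simpa [hq] using h))
    rw [natDegree_minpoly_lehmer hroot] at h1
    have h2 : q.natDegree ≤ 2 := natDegree_quadratic_le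
    omega
  have h0 := congrArg (fun f => f.coeff 0) hq0
  have h1 := congrArg (fun f => f.coeff 1) hq0
  have h2 := congrArg (fun f => f.coeff 2) hq0
  simp only [hq, coeff_add, coeff_C_mul, coeff_X_pow, coeff_X, coeff_C, coeff_zero] at h0 h1 h2
  norm_num at h0 h1 h2
  exact ⟨h2, h1, h0⟩

theorem isGalois_lehmer (hroot : aeval α (lehmerQuintic m) = 0)
    (hgen : IntermediateField.adjoin ℚ {α} = ⊤) : IsGalois ℚ H := by
  have hD : 1 + (m + 2) * α ≠ 0 := fun h => by
    have := quadratic_ne_zero (a := 0) (b := m + 2) (c := 1) hroot (by push_cast; linear_combination h)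
    omega
  -- A rational transformation carrying the root `α` to a different root.
  set β : H := (m + 2 + m * α - α ^ 2) / (1 + (m + 2) * α) with hβ
  have hβ' : β * (1 + (m + 2) * α) = m + 2 + m * α - α ^ 2 := div_mul_cancel₀ _ hD
  have hne : β ≠ α := fun h => by
    rw [h] at hβ'
    have := quadratic_ne_zero (a := m + 3) (b := 1 - m) (c := -(m + 2)) hroot
      (by push_cast; linear_combination hβ')
    omega
  have hβroot : aeval β (lehmerQuintic m) = 0 := by
    rw [aeval_lehmerQuintic] at hroot ⊢
    generalize hM : (m : H) = M at *
    rw [hβ]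
    field_simp
    -- The cleared numerator of `h_m(β)` has degree 10 in `α`; the coefficient is its quotient by
    -- `h_m(α)`.
    linear_combination ((-M ^ 3 - 5 * M ^ 2 - 10 * M - 7)
      + (M ^ 5 + 8 * M ^ 4 + 28 * M ^ 3 + 56 * M ^ 2 + 65 * M + 40) * α
      + (2 * M ^ 5 + 15 * M ^ 4 + 55 * M ^ 3 + 117 * M ^ 2 + 145 * M + 85) * α ^ 2
      + (M ^ 5 + 7 * M ^ 4 + 27 * M ^ 3 + 59 * M ^ 2 + 75 * M + 40) * α ^ 3
      + (M ^ 3 + 3 * M ^ 2 + 5 * M) * α ^ 4 - α ^ 5) * hroot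
  have hint : IsIntegral ℚ α := Algebra.IsIntegral.isIntegral α
  let φ : H →ₐ[ℚ] H := ((IntermediateField.algHomAdjoinIntegralEquiv ℚ hint).symm
    ⟨β, by
      rw [minpoly_eq_lehmerQuintic hroot, mem_aroots]
      exact ⟨((monic_lehmerQuintic m).map _).ne_zero, by rwa [aeval_map_algebraMap]⟩⟩).comp
    ((IntermediateField.equivOfEq hgen).symm.toAlgHom.comp
      IntermediateField.topEquiv.symm.toAlgHom)
  have hφ : φ α = β := IntermediateField.algHomAdjoinIntegralEquiv_symm_apply_gen ℚ hint _
  let σ : Gal(H/ℚ) := AlgEquiv.ofBijective φ (Algebra.IsAlgebraic.algHom_bijective φ)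
  have : IsSimpleOrder (IntermediateField ℚ H) :=
    IntermediateField.isSimpleOrder_of_finrank_prime ℚ H (by
      rw [finrank_lehmer hroot hgen]; norm_num)
  -- Prime degree leaves no proper intermediate field, so one nontrivial automorphism suffices.
  refine IsGalois.of_fixedField_eq_bot ℚ H
    ((IsSimpleOrder.eq_bot_or_eq_top _).resolve_right fun htop => hne ?_)
  have hmem : α ∈ IntermediateField.fixedField (⊤ : Subgroup Gal(H/ℚ)) := htop ▸ trivial
  rw [← hφ]
  exact (IntermediateField.mem_fixedField_iff _ _).mp hmem σ trivial

end Lehmer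

/-! ### Splitting of 2, 3 and 5. -/

section LehmerSplitting

theorem eval_lehmerQuintic (m n : ℤ) :
    (lehmerQuintic m).eval n = n ^ 5 + m ^ 2 * n ^ 4
      - (2 * m ^ 3 + 6 * m ^ 2 + 10 * m + 10) * n ^ 3
      + (m ^ 4 + 5 * m ^ 3 + 11 * m ^ 2 + 15 * m + 5) * n ^ 2
      + (m ^ 3 + 4 * m ^ 2 + 10 * m + 10) * n + 1 := by
  simpa using aeval_lehmerQuintic m n

theorem not_two_dvd_eval_lehmerQuintic (m n : ℤ) : ¬ (2 : ℤ) ∣ (lehmerQuintic m).eval n := by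
  rw [eval_lehmerQuintic]
  intro h
  have h' := (ZMod.intCast_zmod_eq_zero_iff_dvd _ 2).mpr h
  push_cast at h'
  generalize (m : ZMod 2) = a at h'
  generalize (n : ZMod 2) = b at h'
  revert a b; decide

theorem not_three_dvd_eval_lehmerQuintic (m n : ℤ) : ¬ (3 : ℤ) ∣ (lehmerQuintic m).eval n := by
  rw [eval_lehmerQuintic]
  intro h
  have h' := (ZMod.intCast_zmod_eq_zero_iff_dvd _ 3).mpr h
  push_cast at h'
  generalize (m : ZMod 3) = a at h'
  generalize (n : ZMod 3) = b at h'
  revert a b; decide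

theorem five_dvd_of_five_dvd_eval_lehmerQuintic {m n : ℤ} (hm : ¬ m ≡ 2 [ZMOD 5])
    (h : (5 : ℤ) ∣ (lehmerQuintic m).eval n) : (5 : ℤ) ∣ m ∧ (5 : ℤ) ∣ n + 1 := by
  rw [eval_lehmerQuintic] at h
  have h' := (ZMod.intCast_zmod_eq_zero_iff_dvd _ 5).mpr h
  have hm' : (m : ZMod 5) ≠ 2 := fun h => hm ((ZMod.intCast_eq_intCast_iff m 2 5).mp h)
  have key (a b : ZMod 5) : a ≠ 2 → b ^ 5 + a ^ 2 * b ^ 4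
      - (2 * a ^ 3 + 6 * a ^ 2 + 10 * a + 10) * b ^ 3
      + (a ^ 4 + 5 * a ^ 3 + 11 * a ^ 2 + 15 * a + 5) * b ^ 2
      + (a ^ 3 + 4 * a ^ 2 + 10 * a + 10) * b + 1 = 0 → a = 0 ∧ b + 1 = 0 := by
    revert a b; decide
  push_cast at h'
  obtain ⟨h1, h2⟩ := key _ _ hm' h'
  exact ⟨(ZMod.intCast_zmod_eq_zero_iff_dvd m 5).mp h1,
    (ZMod.intCast_zmod_eq_zero_iff_dvd (n + 1) 5).mp (by push_cast; exact h2)⟩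

/-- Here `h_m ≡ (x - 1)^2 (x - 2)(x - 3)(x - 4)` modulo 5. The double root does not prevent
splitting: two consecutive roots force it. -/
theorem five_dvd_eval_lehmerQuintic {m : ℤ} (hm : m ≡ 2 [ZMOD 5]) :
    (5 : ℤ) ∣ (lehmerQuintic m).eval 2 ∧ (5 : ℤ) ∣ (lehmerQuintic m).eval (2 + 1) := by
  have hm' : (m : ZMod 5) = 2 := (ZMod.intCast_eq_intCast_iff m 2 5).mpr hm
  constructor <;>
  · rw [eval_lehmerQuintic]
    refine (ZMod.intCast_zmod_eq_zero_iff_dvd _ 5).mp ?_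
    push_cast
    rw [hm']
    decide

variable {H : Type*} [Field H] {m : ℤ} {θ : 𝓞 H}

theorem dvd_eval_lehmerQuintic_of_sub_mem (hroot : aeval θ (lehmerQuintic m) = 0) {p : ℕ}
    (hp : p.Prime) {P : Ideal (𝓞 H)} (hP : P ≠ ⊤) (hpP : (p : 𝓞 H) ∈ P) {n : ℤ}
    (hn : θ - n ∈ P) : (p : ℤ) ∣ (lehmerQuintic m).eval n := by
  refine intCast_dvd_of_mem hp hP hpP ?_
  have h := sub_dvd_eval_sub θ (n : 𝓞 H) ((lehmerQuintic m).map (algebraMap ℤ (𝓞 H)))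
  rw [eval_map_algebraMap, eval_map_algebraMap, hroot, zero_sub, dvd_neg] at h
  refine Ideal.mem_of_dvd _ ?_ hn
  convert h using 1
  rw [aeval_def, eval₂_at_intCast]
  simp

theorem TotallySplit.exists_dvd_eval_lehmerQuintic (hroot : aeval θ (lehmerQuintic m) = 0) {p : ℕ}
    (hp : p.Prime) (h : TotallySplit H 5 p) : ∃ n : ℤ, (p : ℤ) ∣ (lehmerQuintic m).eval n := by
  obtain ⟨P, -, hP, hpP, hres⟩ := h
  obtain ⟨n, hn⟩ := hres 0 θ
  exact ⟨n, dvd_eval_lehmerQuintic_of_sub_mem hroot hp (hP 0).ne_top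
    (Ideal.mem_iInf.mp (hpP ▸ Ideal.mem_span_singleton_self (p : 𝓞 H)) 0) hn⟩

theorem TotallySplit.five_le (hroot : aeval θ (lehmerQuintic m) = 0) {p : ℕ}
    (hp : p.Prime) (h : TotallySplit H 5 p) : 5 ≤ p := by
  obtain ⟨n, hn⟩ := h.exists_dvd_eval_lehmerQuintic hroot hp
  by_contra! hlt
  interval_cases p
  · exact absurd hp (by norm_num)
  · exact absurd hp (by norm_num)
  · exact not_two_dvd_eval_lehmerQuintic m n hn
  · exact not_three_dvd_eval_lehmerQuintic m n hn
  · exact absurd hp (by norm_num)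

variable [NumberField H]

theorem integralCharpoly_eq_lehmerQuintic (hroot : aeval θ (lehmerQuintic m) = 0)
    (hK : Module.finrank ℚ H = 5) : integralCharpoly θ = lehmerQuintic m := by
  have hroot' : aeval (θ : H) (lehmerQuintic m) = 0 := by
    rw [← map_zero (algebraMap (𝓞 H) H), ← hroot, aeval_algebraMap_apply]
  refine map_injective (algebraMap ℤ ℚ) (algebraMap ℤ ℚ).injective_int ?_
  rw [← minpoly_eq_lehmerQuintic hroot']
  refine (eq_of_monic_of_dvd_of_natDegree_le (minpoly.monic (Algebra.IsIntegral.isIntegral _))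
    ((monic_integralCharpoly θ).map _) (minpoly.dvd _ _ ?_) ?_)
  · rw [aeval_map_algebraMap, aeval_algebraMap_apply, aeval_integralCharpoly, map_zero]
  · rw [(monic_integralCharpoly θ).natDegree_map, natDegree_integralCharpoly, hK,
      natDegree_minpoly_lehmer hroot']

/-- Modulo 5 the only surviving case is `5 ∣ m`, with `θ ≡ -1` at every prime above 5. Splitting
would then give `θ = 5b - 1`, which is refuted modulo 25. -/
theorem not_totallySplit_five (hroot : aeval θ (lehmerQuintic m) = 0) (hm : ¬ m ≡ 2 [ZMOD 5]) :
    ¬ TotallySplit H 5 5 := by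
  rintro ⟨P, -, hP, hpP, hres⟩
  have hp5 : Nat.Prime 5 := by norm_num
  have h5 (i : Fin 5) : ((5 : ℕ) : 𝓞 H) ∈ P i :=
    Ideal.mem_iInf.mp (hpP ▸ Ideal.mem_span_singleton_self ((5 : ℕ) : 𝓞 H)) i
  have hdvd (i : Fin 5) : ∃ n : ℤ, θ - n ∈ P i ∧ (5 : ℤ) ∣ m ∧ (5 : ℤ) ∣ n + 1 := by
    obtain ⟨n, hn⟩ := hres i θ
    exact ⟨n, hn, five_dvd_of_five_dvd_eval_lehmerQuintic hm
      (dvd_eval_lehmerQuintic_of_sub_mem hroot hp5 (hP i).ne_top (h5 i) hn)⟩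
  have hmem : θ + 1 ∈ Ideal.span {((5 : ℕ) : 𝓞 H)} := by
    rw [hpP, Ideal.mem_iInf]
    intro i
    obtain ⟨n, hn, -, c, hc⟩ := hdvd i
    have hc' := congrArg (Int.cast : ℤ → 𝓞 H) hc
    push_cast at hc'
    have : θ + 1 = (θ - n) + ((5 : ℕ) : 𝓞 H) * c := by
      push_cast
      linear_combination hc'
    rw [this]
    exact add_mem hn ((P i).mul_mem_right _ (h5 i))
  obtain ⟨b, hb⟩ := Ideal.mem_span_singleton.mp hmem
  obtain ⟨-, -, ⟨k, rfl⟩, -⟩ := hdvd 0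
  obtain rfl : θ = 5 * b - 1 := by
    push_cast at hb
    linear_combination hb
  rw [aeval_lehmerQuintic] at hroot
  push_cast at hroot
  generalize (k : 𝓞 H) = k at hroot
  -- Expansion of `h_{5k}(5b - 1)`, which is 5 modulo 25; cancelling 5 places 1 in the ideal `(5)`.
  have h25 : (5 : 𝓞 H) * (1 + 5 * ((30 * k ^ 3 + 14 * k ^ 2 + 3 * k + 25 * k ^ 4)
      + (-375 * k ^ 3 - 200 * k ^ 2 - 50 * k - 250 * k ^ 4 - 5) * b
      + (625 * k ^ 4 + 1375 * k ^ 3 + 875 * k ^ 2 + 225 * k + 25) * b ^ 2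
      + (-1250 * k ^ 3 - 1250 * k ^ 2 - 250 * k) * b ^ 3
      + (625 * k ^ 2 - 125) * b ^ 4 + 125 * b ^ 5)) = 0 := by
    linear_combination hroot
  have h1 := (mul_eq_zero.mp h25).resolve_left (by norm_num)
  refine (hP 0).ne_top ((Ideal.eq_top_iff_one _).mpr ?_)
  rw [eq_neg_of_add_eq_zero_left h1]
  exact neg_mem ((P 0).mul_mem_right _ (by simpa using h5 0))

end LehmerSplitting

/-! ### The two invariants of the Lehmer field. -/

theorem theorem6 (m : ℤ)
    (hm : ∀ p : ℕ, p.Prime → p ≠ 5 →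
      ¬ ((p : ℤ) ^ 2 ∣ m ^ 4 + 5 * m ^ 3 + 15 * m ^ 2 + 25 * m + 25))
    (H : Type*) [Field H] [NumberField H] (α : H)
    (hroot : aeval α (lehmerQuintic m) = 0)
    (hgen : IntermediateField.adjoin ℚ {α} = ⊤) :
    fieldIndex H = 1 ∧
      fieldValueLcm H = if m ≡ 2 [ZMOD 5] then 5 else 1 := by
  have hK := finrank_lehmer hroot hgen
  have := isGalois_lehmer hroot hgen
  have hp5 : Nat.Prime 5 := by norm_num
  obtain ⟨θ, rfl⟩ : ∃ θ : 𝓞 H, (θ : H) = α :=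
    ⟨⟨α, lehmerQuintic m, monic_lehmerQuintic m, hroot⟩, rfl⟩
  have hθ : aeval θ (lehmerQuintic m) = 0 := by
    rw [aeval_algebraMap_apply] at hroot
    exact (map_eq_zero_iff _ (FaithfulSMul.algebraMap_injective (𝓞 H) H)).mp hroot
  refine ⟨?_, ?_⟩
  · rw [Nat.eq_one_iff_not_exists_prime_dvd]
    intro p hp hdvd
    obtain ⟨η, hη⟩ := exists_not_dvd_elementIndex hp5 hK hp fun h => h.five_le hθ hp
    refine hη ((dvd_setGcd_iff _ p).mp hdvd _ ⟨η, ?_, rfl⟩)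
    exact mem_primitiveIntegers_of_elementIndex_ne_zero fun h => hη (h ▸ dvd_zero p)
  · have hsplit (η : 𝓞 H) {p : ℕ} (hp : p.Prime) (h : p ∣ valueGcd η) : TotallySplit H 5 p := by
      rw [dvd_valueGcd_iff] at h
      exact totallySplit_of_dvd_eval_integralCharpoly hp5 hK hp η 0 (h _) (h _)
    have hfive (η : 𝓞 H) : valueGcd η ∣ 5 := by
      have hcop {p : ℕ} (hp : p.Prime) (hlt : p < 5) : (valueGcd η).Coprime p :=
        ((Nat.Prime.coprime_iff_not_dvd hp).mpr fun h =>
          hlt.not_ge ((hsplit η hp h).five_le hθ hp)).symm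
      refine Nat.Coprime.dvd_of_dvd_mul_left (k := valueGcd η) (m := 2 ^ 3 * 3) (n := 5) ?_
        (valueGcd_dvd_of_finrank_eq_five hK η)
      exact Nat.Coprime.mul_right ((hcop Nat.prime_two (by norm_num)).pow_right 3)
        (hcop Nat.prime_three (by norm_num))
    split_ifs with hm2
    · refine Nat.dvd_antisymm ((setLcm_dvd_iff _ _).mpr ?_) ?_
      · rintro _ ⟨η, -, rfl⟩
        exact hfive η
      · obtain ⟨h2, h3⟩ := five_dvd_eval_lehmerQuintic hm2
        rw [← integralCharpoly_eq_lehmerQuintic hθ hK] at h2 h3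
        -- The root `θ` only detects the splitting, since `h_m(0) = 1`; another integer `η` has all
        -- its values divisible by 5.
        obtain ⟨η, hη, hdvd⟩ := TotallySplit.exists_dvd_valueGcd hp5
          (totallySplit_of_dvd_eval_integralCharpoly hp5 hK hp5 θ 2 h2 h3)
        exact hdvd.trans ((setLcm_dvd_iff _ _).mp dvd_rfl _ ⟨η, hη, rfl⟩)
    · refine Nat.dvd_one.mp ((setLcm_dvd_iff _ _).mpr ?_)
      rintro _ ⟨η, -, rfl⟩
      rcases (Nat.dvd_prime hp5).mp (hfive η) with h | h
      · exact h.dvd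
      · exact absurd (hsplit η hp5 h.symm.dvd) (not_totallySplit_five hθ hm2)
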